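/- Let $(\mathcal S,\mathcal A,P,r)$ be a Markov decision process with finite nonempty state space $\mathcal S$, finite nonempty action space $\mathcal A$, transition kernel $P:\mathcal S\times\mathcal A\to\Delta(\mathcal S)$ and reward $r:\mathcal S\times\mathcal A\to[0,1]$. Write $P_{sa}v=\sum_{s'}P(s'\mid s,a)v(s')$ for $v\in\mathbb R^{\mathcal S}$ and $\mathrm{sp}(v)=\max v-\min v$. A policy is a map $\pi:\mathcal S\to\Delta(\mathcal A)$; it is deterministic if every $\pi(s)$ is a point mass. $\mathbb E^\pi_s$ is the expectation over trajectories $(S_0,A_0,S_1,A_1,\dots)$ with $S_0=s$, $A_t\sim\pi(S_t)$, $S_{t+1}\sim P(\cdot\mid S_t,A_t)$; put $R_t=r(S_t,A_t)$. Define (suprema over all policies, elementwise) $$V^\pi_\gamma(s)=\mathbb E^\pi_s\Big[\sum_{t\ge0}\gamma^tR_t\Big],\quad V^\star_\gamma=\sup_\pi V^\pi_\gamma,\qquad \rho^\pi(s)=\lim_{T\to\infty}\frac1T\mathbb E^\pi_s\Big[\sum_{t=0}^{T-1}R_t\Big],\quad \rho^\star=\sup_\pi\rho^\pi,$$ and let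 $h^\pi(s)$ be the Cesàro limit, as $T\to\infty$, of $\mathbb E^\pi_s\big[\sum_{t=0}^{T-1}(R_t-\rho^\pi(S_t))\big]$. A policy $\pi^\star$ is Blackwell optimal if there is $\bar\gamma<1$ such that $V^{\pi^\star}_\gamma=V^\star_\gamma$ for all $\gamma\in[0,1)$ with $\gamma\ge\bar\gamma$. Define the gain-dropping times $$\mathsf T^\pi_{\rm drop}=\max_{s\in\mathcal S}\mathbb E^\pi_s\Big[\sum_{t=0}^\infty\mathbb I\big(P_{S_tA_t}\rho^\star<\rho^\star(S_t)\big)\Big],\qquad \mathsf T_{\rm drop}=\max_{\pi\ \text{deterministic}}\mathsf T^\pi_{\rm drop},$$ and, for $V\in\mathbb R^{\mathcal S}$, $$\mathcal T_\gamma(V)(s)=\max_{a}\big(r(s,a)+\gamma P_{sa}V\big),\qquad \mathcal T^\pi_\gamma(V)(s)=\sum_a\pi(a\mid s)\big(r(s,a)+\gamma P_{sa}V\big).$$ Let $\tfrac12\le\gamma<1$, let $V\in\mathbb R^{\mathcal S}$, and let $\pi$ be a (possibly randomized) policy that is greedy with respect to $r+\gamma PV$, that is, $\mathcal T^\pi_\gamma(V)=\mathcal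 T_\gamma(V)$. Let $\pi^\star$ be any Blackwell-optimal policy, and let $h\in\mathbb R^{\mathcal S}$ be such that $(\rho^\star,h)$ satisfies both the modified and the unmodified multichain Bellman equations, that is, for every $s\in\mathcal S$, $$\max_{a}P_{sa}\rho^\star=\rho^\star(s),\qquad \max_{a}\big(r(s,a)+P_{sa}h\big)=\rho^\star(s)+h(s),\qquad \max_{a:\,P_{sa}\rho^\star=\rho^\star(s)}\big(r(s,a)+P_{sa}h\big)=\rho^\star(s)+h(s).$$ Then $\mathsf T^\pi_{\rm drop}$ and $\mathsf T_{\rm drop}$ are finite and, with $$M=\min\big\{\mathrm{sp}(h),\ \mathrm{sp}(h^{\pi^\star})+\mathsf T_{\rm drop}+\mathrm{sp}(h^{\pi^\star})\,\mathsf T_{\rm drop}\big\},$$ we have $$\|\rho^\pi-\rho^\star\|_\infty\le(\mathsf T^\pi_{\rm drop}+1)\Big[(1-\gamma)(4+7M)+16\,\|\mathcal T_\gamma(V)-V\|_\infty\Big].$$ -/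

import Mathlib

open MeasureTheory ProbabilityTheory Filter Topology
open scoped ENNReal

/-- A Markov decision process with state space `S`, action space `A`, transition kernel `P` and
reward function `r` with values in `[0, 1]`. -/
structure FiniteMDP (S A : Type*) where
  /-- `P s a` is the law of the next state when action `a` is taken in state `s`. -/
  P : S → A → PMF S
  /-- The reward of action `a` in state `s`. -/
  r : S → A → ℝ
  r_mem : ∀ s a, r s a ∈ Set.Icc (0 : ℝ) 1

/-- A (randomized, Markovian, stationary) policy: a law on actions for every state. -/
abbrev Policy (S A : Type*) := S → PMF A

/-- The deterministic policy that takes action `f s` in state `s`. -/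
noncomputable def Policy.det {S A : Type*} (f : S → A) : Policy S A := fun s => PMF.pure (f s)

/-- The span seminorm `max v - min v`. -/
noncomputable def spanSeminorm {S : Type*} [Fintype S] [Nonempty S] (v : S → ℝ) : ℝ :=
  Finset.univ.sup' Finset.univ_nonempty v - Finset.univ.inf' Finset.univ_nonempty v

/-- The Cesaro limit of `x 1, x 2, …`, that is, the limit of `(x 1 + ⋯ + x N) / N`. -/
noncomputable def cesaroLim (x : ℕ → ℝ) : ℝ :=
  limUnder atTop (fun N : ℕ => (∑ T ∈ Finset.Icc 1 N, x T) / (N : ℝ))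

namespace FiniteMDP

section Trajectories

variable {S A : Type*} [MeasurableSpace S] [MeasurableSpace A]

/-- The law of the state-action pair `(s, a)` with `s ∼ μ` and `a ∼ π s`. -/
noncomputable def pairLaw (μ : PMF S) (π : Policy S A) : PMF (S × A) :=
  μ.bind fun s => (π s).map fun a => (s, a)

variable [Finite S] [MeasurableSingletonClass S] [Finite A] [MeasurableSingletonClass A]

/-- The transition kernel of the state-action process under the policy `π`:
from `(s, a)` the next state is drawn from `P s a`, and the next action from `π`. -/
noncomputable def stepKernel (m : FiniteMDP S A) (π : Policy S A) : Kernel (S × A) (S × A) :=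
  Kernel.ofFunOfCountable fun x => (pairLaw (m.P x.1 x.2) π).toMeasure

instance (m : FiniteMDP S A) (π : Policy S A) : IsMarkovKernel (m.stepKernel π) :=
  ⟨fun x => PMF.toMeasure.isProbabilityMeasure (pairLaw (m.P x.1 x.2) π)⟩

/-- The law of the trajectory `(S₀, A₀), (S₁, A₁), …` with `S₀ = s`, `Aₜ ∼ π Sₜ` and
`Sₜ₊₁ ∼ P Sₜ Aₜ`. -/
noncomputable def trajLaw (m : FiniteMDP S A) (π : Policy S A) (s : S) : Measure (ℕ → S × A) :=
  Kernel.trajMeasure (X := fun _ : ℕ => S × A) (pairLaw (PMF.pure s) π).toMeasure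
    fun n => (m.stepKernel π).comap
      (fun x : (i : Finset.Iic n) → S × A => x ⟨n, Finset.mem_Iic.2 le_rfl⟩)
      (measurable_pi_apply _)

/-- The discounted value function of `π`. -/
noncomputable def discValue (m : FiniteMDP S A) (γ : ℝ) (π : Policy S A) (s : S) : ℝ :=
  ∫ ω, ∑' t : ℕ, γ ^ t * m.r (ω t).1 (ω t).2 ∂(m.trajLaw π s)

/-- The optimal discounted value function. -/
noncomputable def optDiscValue (m : FiniteMDP S A) (γ : ℝ) (s : S) : ℝ :=
  ⨆ π : Policy S A, m.discValue γ π s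

/-- The gain (long-run average reward) of `π`. -/
noncomputable def gain (m : FiniteMDP S A) (π : Policy S A) (s : S) : ℝ :=
  limUnder atTop fun T : ℕ =>
    (∫ ω, ∑ t ∈ Finset.range T, m.r (ω t).1 (ω t).2 ∂(m.trajLaw π s)) / (T : ℝ)

/-- The optimal gain. -/
noncomputable def optGain (m : FiniteMDP S A) (s : S) : ℝ :=
  ⨆ π : Policy S A, m.gain π s

/-- The bias function of `π`. -/
noncomputable def bias (m : FiniteMDP S A) (π : Policy S A) (s : S) : ℝ :=
  cesaroLim fun T : ℕ =>
    ∫ ω, ∑ t ∈ Finset.range T, (m.r (ω t).1 (ω t).2 - m.gain π (ω t).1) ∂(m.trajLaw π s)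

/-- `π` is Blackwell optimal: it is discounted optimal for all discount factors close to `1`. -/
def IsBlackwellOptimal (m : FiniteMDP S A) (π : Policy S A) : Prop :=
  ∃ γ₀ < (1 : ℝ), ∀ γ : ℝ, 0 ≤ γ → γ₀ ≤ γ → γ < 1 → m.discValue γ π = m.optDiscValue γ

end Trajectories

/-- `P_{sa} v`, the expectation of `v` at the next state. -/
noncomputable def nextExp {S A : Type*} [Fintype S] (m : FiniteMDP S A) (v : S → ℝ)
    (s : S) (a : A) : ℝ :=
  ∑ s', (m.P s a s').toReal * v s'

section Bellman

variable {S A : Type*} [Fintype S] [Fintype A]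

/-- The discounted Bellman evaluation operator of the policy `π`. -/
noncomputable def evalOp (m : FiniteMDP S A) (γ : ℝ) (π : Policy S A) (V : S → ℝ) (s : S) : ℝ :=
  ∑ a, (π s a).toReal * (m.r s a + γ * m.nextExp V s a)

/-- The discounted Bellman operator. -/
noncomputable def bellmanOp [Nonempty A] (m : FiniteMDP S A) (γ : ℝ) (V : S → ℝ) (s : S) : ℝ :=
  Finset.univ.sup' Finset.univ_nonempty fun a => m.r s a + γ * m.nextExp V s a

/-- The (standard, unmodified) multichain optimality equations. -/
def UnmodifiedBellman (m : FiniteMDP S A) (ρ h : S → ℝ) : Prop :=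
  (∀ s, IsGreatest (Set.range fun a => m.nextExp ρ s a) (ρ s)) ∧
  ∀ s, IsGreatest ((fun a => m.r s a + m.nextExp h s a) '' {a | m.nextExp ρ s a = ρ s})
    (ρ s + h s)

/-- The modified multichain optimality equations. -/
def ModifiedBellman (m : FiniteMDP S A) (ρ h : S → ℝ) : Prop :=
  (∀ s, IsGreatest (Set.range fun a => m.nextExp ρ s a) (ρ s)) ∧
  ∀ s, IsGreatest (Set.range fun a => m.r s a + m.nextExp h s a) (ρ s + h s)

end Bellman

section Drop

variable {S A : Type*} [Fintype S] [MeasurableSpace S] [MeasurableSingletonClass S]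
  [Fintype A] [MeasurableSpace A] [MeasurableSingletonClass A]

/-- The state-action pairs `(s, a)` that drop the optimal gain: `P_{sa} ρ* < ρ*(s)`. -/
def dropSet (m : FiniteMDP S A) : Set (S × A) :=
  {x | m.nextExp m.optGain x.1 x.2 < m.optGain x.1}

/-- The maximum over starting states of the expected number of gain-dropping actions that are
taken by `π`. -/
noncomputable def dropTime (m : FiniteMDP S A) (π : Policy S A) : ℝ≥0∞ :=
  ⨆ s, ∫⁻ ω, ∑' t : ℕ, m.dropSet.indicator 1 (ω t) ∂(m.trajLaw π s)

/-- The gain-dropping time: the maximum of `dropTime` over all deterministic policies. -/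
noncomputable def maxDropTime (m : FiniteMDP S A) : ℝ≥0∞ :=
  ⨆ f : S → A, m.dropTime (Policy.det f)

end Drop

end FiniteMDP

/-! Write `δ` for the Bellman residual of `V` and `ρ*` for the optimal gain. Two facts carry the
proof.

First, `V` lies within `B = M + δ / (1 - γ)` of `ρ* / (1 - γ)`. Both sides follow from the maximum
principle for `1 - γ P`. From above, `V` is compared along a deterministic greedy selector with `ρ*
/ (1 - γ) + (h - min h) + K D`, where `D` counts the expected gain drops of that selector and `K`
pays for the advantage a dropping action may have. The modified equation allows `K = 0`; the
Blackwell bias needs `K = 1 + sp`. From below, a policy that preserves `ρ*` and has `h` as a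
subsolution suffices: a selector from the unmodified equation, or the Blackwell policy itself. Each
choice of `h` gives one term of the minimum `M` (`abs_sub_optGain_le_of_bellman`,
`abs_sub_optGain_le_of_blackwell`).

Second, `ρ* / (1 - γ)` dominates `V`, so an action that is greedy for `V` can lower `ρ*` only by a
small `c`, of order `(1 - γ) (1 + B)` plus residual. Hence `ρ* - c D`, now with `D` for `π`, is
nondecreasing in expectation along `π`. The greedy equation says that the reward of `π` is at least
`ρ* - (1 - γ) B - δ` up to a coboundary, and coboundaries vanish in long-run averages. Averaging
gives `gain π ≥ ρ* - c D - (1 - γ) B - δ` (`optGain_sub_gain_le`), and `γ ≥ 1/2` fixes `c`. -/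

/-! ### Ergodic theory and resolvents of finite Markov operators. -/

/-- A linear operator on functions that is positive and fixes the constant `1`. -/
structure IsMarkovOp {S : Type*} (P : (S → ℝ) →ₗ[ℝ] (S → ℝ)) : Prop where
  nonneg : ∀ v, 0 ≤ v → 0 ≤ P v
  one : P 1 = 1

namespace IsMarkovOp

variable {S : Type*} {P : (S → ℝ) →ₗ[ℝ] (S → ℝ)}

theorem mono (hP : IsMarkovOp P) {v w : S → ℝ} (h : v ≤ w) : P v ≤ P w := by
  have := hP.nonneg (w - v) (sub_nonneg.2 h)
  rwa [map_sub, sub_nonneg] at this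

theorem const (hP : IsMarkovOp P) (c : ℝ) : P (fun _ => c) = fun _ => c := by
  have : (fun _ : S => c) = c • (1 : S → ℝ) := by ext; simp
  rw [this, map_smul, hP.one]

theorem pow (hP : IsMarkovOp P) (n : ℕ) : IsMarkovOp (P ^ n) := by
  induction n with
  | zero => exact ⟨fun v hv => hv, rfl⟩
  | succ n ih =>
    refine ⟨fun v hv => ?_, ?_⟩
    · rw [pow_succ, Module.End.mul_apply]
      exact ih.nonneg _ (hP.nonneg _ hv)
    · rw [pow_succ, Module.End.mul_apply, hP.one, ih.one]

theorem apply_le (hP : IsMarkovOp P) {v : S → ℝ} {c : ℝ} (h : ∀ s, v s ≤ c) (s : S) :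
    P v s ≤ c := by
  have := hP.mono (v := v) (w := fun _ => c) h s
  rwa [hP.const] at this

theorem le_apply (hP : IsMarkovOp P) {v : S → ℝ} {c : ℝ} (h : ∀ s, c ≤ v s) (s : S) :
    c ≤ P v s := by
  have := hP.mono (v := fun _ => c) (w := v) h s
  rwa [hP.const] at this

variable [Fintype S] in
theorem abs_apply_le (hP : IsMarkovOp P) (v : S → ℝ) (s : S) : |P v s| ≤ ‖v‖ :=
  abs_le.2 ⟨hP.le_apply (fun s => (abs_le.1 (norm_le_pi_norm v s)).1) s,
    hP.apply_le (fun s => (abs_le.1 (norm_le_pi_norm v s)).2) s⟩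

theorem pow_fixed {u : S → ℝ} (hu : P u = u) (n : ℕ) : (P ^ n) u = u := by
  induction n with
  | zero => rfl
  | succ n ih => rw [pow_succ, Module.End.mul_apply, hu, ih]

theorem sum_pow_sub (w : S → ℝ) (n : ℕ) :
    ∑ t ∈ Finset.range n, (P ^ t) (w - P w) = w - (P ^ n) w := by
  induction n with
  | zero => simp
  | succ n ih =>
    rw [Finset.sum_range_succ, ih, map_sub, pow_succ, Module.End.mul_apply]
    abel

variable [Fintype S]

/-- If `d = x - P x` is fixed, the telescoping sum gives `n d = x - P ^ n x`, which stays bounded in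
`n`; so `d = 0`. -/
theorem sub_apply_eq_zero_of_fixed (hP : IsMarkovOp P) {x : S → ℝ} (hx : P (x - P x) = x - P x) :
    x - P x = 0 := by
  ext s
  have key : ∀ n : ℕ, (n : ℝ) * |(x - P x) s| ≤ 2 * ‖x‖ := fun n => by
    have h1 := congrFun (sum_pow_sub (P := P) x n) s
    simp only [pow_fixed hx, Finset.sum_const, Finset.card_range] at h1
    have h2 : (n : ℝ) * |(x - P x) s| = |x s - (P ^ n) x s| := by
      rw [← Nat.abs_cast n, ← abs_mul]
      congr 1
      simpa using h1
    rw [h2]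
    have := abs_sub (x s) ((P ^ n) x s)
    have h3 := (hP.pow n).abs_apply_le x s
    have h4 : |x s| ≤ ‖x‖ := norm_le_pi_norm x s
    linarith
  by_contra hne
  have hpos : 0 < |(x - P x) s| := abs_pos.2 hne
  obtain ⟨n, hn⟩ := exists_nat_gt (2 * ‖x‖ / |(x - P x) s|)
  rw [div_lt_iff₀ hpos] at hn
  exact absurd (key n) (not_le.2 hn)

/-- The ergodic decomposition of a vector. -/
theorem exists_decomp (hP : IsMarkovOp P) (x : S → ℝ) :
    ∃ u w, P u = u ∧ x = u + (w - P w) := by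
  set Q : (S → ℝ) →ₗ[ℝ] (S → ℝ) := LinearMap.id - P with hQ
  -- Kernel and range of `1 - P` meet trivially, so rank-nullity makes them complementary: the mean
  -- ergodic theorem in finite dimension.
  have hd : Disjoint (LinearMap.ker Q) (LinearMap.range Q) := by
    rw [Submodule.disjoint_def]
    rintro y hy ⟨w, rfl⟩
    rw [LinearMap.mem_ker] at hy
    simp only [hQ, LinearMap.sub_apply, LinearMap.id_apply] at hy ⊢
    exact hP.sub_apply_eq_zero_of_fixed (sub_eq_zero.1 hy).symm
  have htop : LinearMap.ker Q ⊔ LinearMap.range Q = ⊤ := by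
    apply Submodule.eq_top_of_disjoint _ _ _ hd
    rw [add_comm, Q.finrank_range_add_finrank_ker]
  have hx : x ∈ LinearMap.ker Q ⊔ LinearMap.range Q := htop ▸ Submodule.mem_top
  obtain ⟨u, hu, _, ⟨w, rfl⟩, rfl⟩ := Submodule.mem_sup.1 hx
  refine ⟨u, w, ?_, rfl⟩
  rw [LinearMap.mem_ker] at hu
  simp only [hQ, LinearMap.sub_apply, LinearMap.id_apply] at hu
  exact (sub_eq_zero.1 hu).symm

theorem tendsto_pow_div (hP : IsMarkovOp P) (w : S → ℝ) (s : S) :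
    Tendsto (fun n : ℕ => (P ^ n) w s / (n : ℝ)) atTop (𝓝 0) := by
  refine squeeze_zero_norm (a := fun n : ℕ => ‖w‖ / (n : ℝ)) (fun n => ?_)
    (tendsto_const_div_atTop_nhds_zero_nat _)
  rw [norm_div, Real.norm_natCast]
  exact div_le_div_of_nonneg_right ((hP.pow n).abs_apply_le w s) (Nat.cast_nonneg n)

/-- The invariant part contributes `u` at every time, while the coboundary telescopes to a bounded
term that disappears after division by `n`. -/
theorem tendsto_average (hP : IsMarkovOp P) {u : S → ℝ} (hu : P u = u) (w : S → ℝ) (s : S) :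
    Tendsto (fun n : ℕ => (∑ t ∈ Finset.range n, (P ^ t) (u + (w - P w)) s) / (n : ℝ)) atTop
      (𝓝 (u s)) := by
  have h1 : Tendsto (fun n : ℕ => u s + (w s / (n : ℝ) - (P ^ n) w s / (n : ℝ))) atTop
      (𝓝 (u s + (0 - 0))) :=
    tendsto_const_nhds.add ((tendsto_const_div_atTop_nhds_zero_nat _).sub (hP.tendsto_pow_div w s))
  rw [sub_zero, add_zero] at h1
  refine h1.congr' ?_
  filter_upwards [eventually_gt_atTop 0] with n hn
  have hn' : (n : ℝ) ≠ 0 := Nat.cast_ne_zero.2 hn.ne'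
  have h2 := congrFun (sum_pow_sub (P := P) w n) s
  rw [Finset.sum_apply] at h2
  simp only [map_add, pow_fixed hu, Pi.add_apply, Finset.sum_add_distrib, h2, Finset.sum_const,
    Finset.card_range, Pi.sub_apply, nsmul_eq_mul]
  field_simp

/-- An excessive lower bound, up to a coboundary, of an invariant function is a lower bound. -/
theorem le_of_fixed_of_le (hP : IsMarkovOp P) {u g x : S → ℝ} (hu : P u = u) (hg : g ≤ P g)
    (h : g + (x - P x) ≤ u) : g ≤ u := by
  have hgn : ∀ n : ℕ, g ≤ (P ^ n) g := fun n => by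
    induction n with
    | zero => exact le_rfl
    | succ n ih =>
      rw [pow_succ, Module.End.mul_apply]
      exact ih.trans ((hP.pow n).mono hg)
  intro s
  -- Apply `P ^ t` to the hypothesis and average over `t < n`: `u` is unchanged, `g` can only grow,
  -- and the coboundary telescopes.
  have h1 : Tendsto (fun n : ℕ => (x s / (n : ℝ) - (P ^ n) x s / (n : ℝ)) + g s) atTop
      (𝓝 ((0 - 0) + g s)) :=
    ((tendsto_const_div_atTop_nhds_zero_nat _).sub (hP.tendsto_pow_div x s)).add tendsto_const_nhds
  rw [sub_zero, zero_add] at h1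
  refine le_of_tendsto h1 ?_
  filter_upwards [eventually_gt_atTop 0] with n hn
  have hn' : (0 : ℝ) < n := Nat.cast_pos.2 hn
  have h2 := congrFun (sum_pow_sub (P := P) x n) s
  rw [Finset.sum_apply] at h2
  have h3 : ∑ t ∈ Finset.range n, (g s + (P ^ t) (x - P x) s) ≤ ∑ t ∈ Finset.range n, u s := by
    refine Finset.sum_le_sum fun t _ => ?_
    have h4 := (hP.pow t).mono h s
    rw [pow_fixed hu, map_add, Pi.add_apply] at h4
    exact (add_le_add_left (hgn t s) _).trans h4
  rw [Finset.sum_add_distrib, h2] at h3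
  simp only [Finset.sum_const, Finset.card_range, nsmul_eq_mul, Pi.sub_apply] at h3
  rw [← sub_div, ← le_sub_iff_add_le, div_le_iff₀ hn']
  linarith

variable [Nonempty S]

/-- The maximum principle for discounted subsolutions. -/
theorem le_of_le_discount (hP : IsMarkovOp P) {γ c : ℝ} (hγ : 0 ≤ γ) (hγ' : γ < 1) {Y : S → ℝ}
    (h : ∀ s, Y s ≤ γ * P Y s + c) (s : S) : Y s ≤ c / (1 - γ) := by
  obtain ⟨s₀, hs₀⟩ := Finite.exists_max Y
  refine (hs₀ s).trans ?_
  rw [le_div_iff₀ (by linarith)]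
  have := mul_le_mul_of_nonneg_left (hP.apply_le hs₀ s₀) hγ
  linarith [h s₀]

theorem le_of_discount_le (hP : IsMarkovOp P) {γ c : ℝ} (hγ : 0 ≤ γ) (hγ' : γ < 1) {Y : S → ℝ}
    (h : ∀ s, γ * P Y s + c ≤ Y s) (s : S) : c / (1 - γ) ≤ Y s := by
  have := hP.le_of_le_discount hγ hγ' (Y := -Y) (c := -c)
    (fun s => by simp only [map_neg, Pi.neg_apply]; linarith [h s]) s
  rw [neg_div, Pi.neg_apply] at this
  linarith

/-- The first-order expansion of the resolvent as the discount factor tends to `1`. -/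
theorem abs_resolvent_sub_le (hP : IsMarkovOp P) {γ : ℝ} (hγ : 0 ≤ γ) (hγ' : γ < 1)
    {r V u y : S → ℝ} (hu : P u = u) (hr : r = u + ((y - P y) - P (y - P y)))
    (hV : V = r + γ • P V) (s : S) :
    |V s - (u s / (1 - γ) + (y - P y) s)| ≤ 2 * (1 - γ) * ‖P y‖ := by
  have h1 : 0 < 1 - γ := by linarith
  set z := P y with hz
  -- The correction `(1 - γ) z` cancels the first-order residual of the expansion. What remains is
  -- `(1 - γ) ^ 2 * P z`, and the maximum principle costs only one factor `1 - γ`.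
  set Y : S → ℝ := fun s => V s - (u s / (1 - γ) + (y - z) s) + (1 - γ) * z s with hY
  have hPY : ∀ s, Y s = γ * P Y s + (1 - γ) ^ 2 * P z s := fun s => by
    have e : Y = V - ((1 - γ)⁻¹ • u + (y - z)) + (1 - γ) • z := by
      ext s
      simp only [hY, Pi.add_apply, Pi.sub_apply, Pi.smul_apply, smul_eq_mul]
      rw [div_eq_inv_mul]
    have e2 := congrFun hV s
    rw [e]
    simp only [map_add, map_sub, map_smul, hu, ← hz, Pi.add_apply, Pi.sub_apply, Pi.smul_apply,
      smul_eq_mul] at e2 ⊢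
    rw [e2, hr]
    simp only [map_sub, ← hz, Pi.add_apply, Pi.sub_apply]
    field_simp
    ring
  have hz' : ∀ s, |P z s| ≤ ‖z‖ := hP.abs_apply_le z
  have hup : ∀ s, Y s ≤ (1 - γ) ^ 2 * ‖z‖ / (1 - γ) := hP.le_of_le_discount hγ hγ' fun s => by
    rw [hPY s]
    gcongr
    exact (abs_le.1 (hz' s)).2
  have hlo : ∀ s, (1 - γ) ^ 2 * (-‖z‖) / (1 - γ) ≤ Y s := hP.le_of_discount_le hγ hγ' fun s => by
    conv_rhs => rw [hPY s]
    gcongr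
    exact (abs_le.1 (hz' s)).1
  have e1 : ∀ c : ℝ, (1 - γ) ^ 2 * c / (1 - γ) = (1 - γ) * c := fun c => by field_simp
  simp only [e1] at hup hlo
  have h2 : |z s| ≤ ‖z‖ := norm_le_pi_norm z s
  have h3 := mul_le_mul_of_nonneg_left (abs_le.1 h2).1 h1.le
  have h4 := mul_le_mul_of_nonneg_left (abs_le.1 h2).2 h1.le
  have h5 := hup s
  have h6 := hlo s
  simp only [hY] at h5 h6
  rw [abs_le]
  constructor <;> linarith

end IsMarkovOp

/-! ### Averages over actions and the transition operator of a policy. -/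

theorem PMF.sum_toReal {α : Type*} [Fintype α] (p : PMF α) : ∑ a, (p a).toReal = 1 := by
  rw [← ENNReal.toReal_sum fun a _ => p.apply_ne_top a, ← tsum_fintype (L := .unconditional _), p.tsum_coe,
    ENNReal.toReal_one]

/-- The expectation of `f s ·` under the law `π s`. -/
noncomputable def Policy.avg {S A : Type*} [Fintype A] (π : Policy S A) (f : S → A → ℝ) (s : S) :
    ℝ :=
  ∑ a, (π s a).toReal * f s a

theorem Policy.avg_const {S A : Type*} [Fintype A] (π : Policy S A) (f : S → ℝ) (s : S) :
    π.avg (fun s _ => f s) s = f s := by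
  rw [Policy.avg, ← Finset.sum_mul, PMF.sum_toReal, one_mul]

theorem Policy.avg_mono {S A : Type*} [Fintype A] (π : Policy S A) {f g : S → A → ℝ} {s : S}
    (h : ∀ a, f s a ≤ g s a) : π.avg f s ≤ π.avg g s :=
  Finset.sum_le_sum fun a _ => mul_le_mul_of_nonneg_left (h a) ENNReal.toReal_nonneg

theorem Policy.avg_le {S A : Type*} [Fintype A] (π : Policy S A) {f : S → A → ℝ} {s : S} {c : ℝ}
    (h : ∀ a, f s a ≤ c) : π.avg f s ≤ c :=
  (π.avg_mono (g := fun _ _ => c) h).trans_eq (π.avg_const (fun _ => c) s)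

theorem Policy.le_avg {S A : Type*} [Fintype A] (π : Policy S A) {f : S → A → ℝ} {s : S} {c : ℝ}
    (h : ∀ a, c ≤ f s a) : c ≤ π.avg f s :=
  (π.avg_const (fun _ => c) s).symm.trans_le (π.avg_mono (f := fun _ _ => c) h)

theorem Policy.avg_det {S A : Type*} [Fintype A] (f : S → A) (g : S → A → ℝ) (s : S) :
    (Policy.det f).avg g s = g s (f s) := by
  classical
  simp [Policy.avg, Policy.det, PMF.pure_apply, apply_ite ENNReal.toReal]

/-- If the average of `f s ·` attains the upper bound `c`, so does `f s a` for every action `a`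
that has positive probability. -/
theorem Policy.eq_of_avg_eq {S A : Type*} [Fintype A] (π : Policy S A) {f : S → A → ℝ} {s : S}
    {c : ℝ} (h : ∀ a, f s a ≤ c) (hc : π.avg f s = c) {a : A} (ha : π s a ≠ 0) : f s a = c := by
  have h1 : ∑ b, (π s b).toReal * (c - f s b) = 0 := by
    simp only [mul_sub, Finset.sum_sub_distrib, ← Finset.sum_mul, PMF.sum_toReal, one_mul]
    exact sub_eq_zero.2 hc.symm
  rw [Finset.sum_eq_zero_iff_of_nonneg fun b _ =>
    mul_nonneg ENNReal.toReal_nonneg (sub_nonneg.2 (h b))] at h1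
  rcases mul_eq_zero.1 (h1 a (Finset.mem_univ a)) with h2 | h2
  · exact absurd h2 (ENNReal.toReal_ne_zero.2 ⟨ha, (π s).apply_ne_top a⟩)
  · linarith

namespace FiniteMDP

section Operators

variable {S A : Type*} [Fintype S] (m : FiniteMDP S A)

theorem nextExp_mono {v w : S → ℝ} (h : v ≤ w) (s : S) (a : A) :
    m.nextExp v s a ≤ m.nextExp w s a :=
  Finset.sum_le_sum fun s' _ => mul_le_mul_of_nonneg_left (h s') ENNReal.toReal_nonneg

theorem nextExp_const (c : ℝ) (s : S) (a : A) : m.nextExp (fun _ => c) s a = c := by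
  rw [nextExp, ← Finset.sum_mul, PMF.sum_toReal, one_mul]

theorem nextExp_add (v w : S → ℝ) (s : S) (a : A) :
    m.nextExp (fun s => v s + w s) s a = m.nextExp v s a + m.nextExp w s a := by
  simp [nextExp, mul_add, Finset.sum_add_distrib]

theorem nextExp_mul (c : ℝ) (v : S → ℝ) (s : S) (a : A) :
    m.nextExp (fun s => c * v s) s a = c * m.nextExp v s a := by
  simp only [nextExp, Finset.mul_sum]
  exact Finset.sum_congr rfl fun _ _ => mul_left_comm _ _ _

theorem nextExp_le {v : S → ℝ} {c : ℝ} (h : ∀ s, v s ≤ c) (s : S) (a : A) :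
    m.nextExp v s a ≤ c :=
  (m.nextExp_mono (w := fun _ => c) h s a).trans_eq (m.nextExp_const c s a)

theorem le_nextExp {v : S → ℝ} {c : ℝ} (h : ∀ s, c ≤ v s) (s : S) (a : A) :
    c ≤ m.nextExp v s a :=
  (m.nextExp_const c s a).symm.trans_le (m.nextExp_mono (v := fun _ => c) h s a)

variable [Fintype A]

/-- The transition operator of the state process under the policy `π`. -/
noncomputable def policyOp (π : Policy S A) : (S → ℝ) →ₗ[ℝ] (S → ℝ) where
  toFun v := π.avg (m.nextExp v)
  map_add' v w := by
    ext s
    have h : m.nextExp (v + w) s = fun a => m.nextExp v s a + m.nextExp w s a :=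
      funext (m.nextExp_add v w s)
    simp [Policy.avg, h, mul_add, Finset.sum_add_distrib]
  map_smul' c v := by
    ext s
    have h : m.nextExp (c • v) s = fun a => c * m.nextExp v s a := funext (m.nextExp_mul c v s)
    simp only [Policy.avg, h, RingHom.id_apply, Pi.smul_apply, smul_eq_mul, Finset.mul_sum]
    exact Finset.sum_congr rfl fun _ _ => mul_left_comm _ _ _

theorem policyOp_apply (π : Policy S A) (v : S → ℝ) (s : S) :
    m.policyOp π v s = π.avg (m.nextExp v) s := rfl

theorem isMarkovOp_policyOp (π : Policy S A) : IsMarkovOp (m.policyOp π) where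
  nonneg v hv s := π.le_avg fun a => m.le_nextExp hv s a
  one := by
    ext s
    rw [policyOp_apply, show (1 : S → ℝ) = fun _ => 1 from rfl]
    simp only [Policy.avg, nextExp_const, mul_one, PMF.sum_toReal]

theorem evalOp_eq (γ : ℝ) (π : Policy S A) (V : S → ℝ) (s : S) :
    m.evalOp γ π V s = π.avg m.r s + γ * m.policyOp π V s := by
  simp only [evalOp, policyOp_apply, Policy.avg, mul_add, Finset.sum_add_distrib, Finset.mul_sum]
  congr 1
  exact Finset.sum_congr rfl fun _ _ => mul_left_comm _ _ _

end Operators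

/-! ### Expectations along trajectories as powers of the transition operator. -/

section Expectations

variable {S A : Type*} [Fintype S] [MeasurableSpace S] [MeasurableSingletonClass S]
  [Fintype A] [MeasurableSpace A] [MeasurableSingletonClass A] (m : FiniteMDP S A)

omit [Fintype S] [MeasurableSpace S] [MeasurableSingletonClass S]
  [Fintype A] [MeasurableSpace A] [MeasurableSingletonClass A] in
theorem pairLaw_apply (μ : PMF S) (π : Policy S A) (x : S × A) :
    pairLaw μ π x = μ x.1 * π x.1 x.2 := by
  classical
  obtain ⟨s, a⟩ := x
  rw [pairLaw, PMF.bind_apply, tsum_eq_single s]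
  · rw [PMF.map_apply, tsum_eq_single a]
    · simp
    · intro b hb
      simp [hb.symm]
  · intro s' hs'
    simp [PMF.map_apply, hs'.symm]

theorem integral_pairLaw (μ : PMF S) (π : Policy S A) (f : S × A → ℝ) :
    ∫ x, f x ∂(pairLaw μ π).toMeasure = ∑ s, (μ s).toReal * π.avg (fun s a => f (s, a)) s := by
  rw [PMF.integral_eq_sum, Fintype.sum_prod_type]
  simp only [pairLaw_apply, ENNReal.toReal_mul, smul_eq_mul, Policy.avg, Finset.mul_sum, mul_assoc]

instance (μ : PMF S) (π : Policy S A) : IsProbabilityMeasure (pairLaw μ π).toMeasure :=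
  PMF.toMeasure.isProbabilityMeasure _

instance (π : Policy S A) (s : S) : IsProbabilityMeasure (m.trajLaw π s) := by
  unfold trajLaw
  infer_instance

theorem integrable_apply (π : Policy S A) (s : S) (f : S × A → ℝ) (t : ℕ) :
    Integrable (fun ω => f (ω t)) (m.trajLaw π s) := by
  refine Integrable.of_bound (C := ‖f‖) ?_ (ae_of_all _ fun ω => norm_le_pi_norm f (ω t))
  exact ((Measurable.of_discrete (f := f)).comp (measurable_pi_apply t)).aestronglyMeasurable

theorem integral_apply_zero (π : Policy S A) (s : S) (f : S × A → ℝ) :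
    ∫ ω, f (ω 0) ∂(m.trajLaw π s) = π.avg (fun s a => f (s, a)) s := by
  classical
  have h : (m.trajLaw π s).map (fun ω => ω 0) = (pairLaw (PMF.pure s) π).toMeasure := by
    have h0 : (fun ω : ℕ → S × A => ω 0) =
        (fun x : (i : Finset.Iic 0) → S × A => x ⟨0, Finset.mem_Iic.2 le_rfl⟩) ∘
          (Preorder.frestrictLe (π := fun _ : ℕ => S × A) 0) := rfl
    rw [h0, ← Measure.map_map (by fun_prop) (by fun_prop), trajLaw, Kernel.trajMeasure,
      Measure.map_comp _ _ (by fun_prop), Kernel.traj_map_frestrictLe, Kernel.partialTraj_self,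
      Measure.id_comp, Measure.map_map (by fun_prop) (by fun_prop)]
    exact Measure.map_id
  have h2 : ∫ x, f x ∂((m.trajLaw π s).map (fun ω => ω 0)) = ∫ ω, f (ω 0) ∂(m.trajLaw π s) :=
    integral_map (measurable_pi_apply 0).aemeasurable
      (Measurable.of_discrete (f := f)).aestronglyMeasurable
  rw [← h2, h, integral_pairLaw, Finset.sum_eq_single s]
  · simp
  · intro b _ hb
    simp [hb]
  · simp

/-- The Markov property: the joint law of the history up to `t` and the next pair is the history law
composed with the step kernel, so the next pair can be integrated out first. -/
theorem integral_apply_succ (π : Policy S A) (s : S) (f : S × A → ℝ) (t : ℕ) :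
    ∫ ω, f (ω (t + 1)) ∂(m.trajLaw π s) =
      ∫ ω, m.nextExp (π.avg fun s a => f (s, a)) (ω t).1 (ω t).2 ∂(m.trajLaw π s) := by
  set κ : (n : ℕ) → Kernel ((i : Finset.Iic n) → S × A) (S × A) := fun n =>
    (m.stepKernel π).comap (fun x : (i : Finset.Iic n) → S × A => x ⟨n, Finset.mem_Iic.2 le_rfl⟩)
      (measurable_pi_apply _) with hκ
  have key : (m.trajLaw π s).map (Preorder.frestrictLe (π := fun _ : ℕ => S × A) t) ⊗ₘ κ t =
      (m.trajLaw π s).map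
        (fun x => (Preorder.frestrictLe (π := fun _ : ℕ => S × A) t x, x (t + 1))) :=
    Kernel.map_frestrictLe_trajMeasure_compProd_eq_map_trajMeasure (X := fun _ : ℕ => S × A)
      (μ₀ := (pairLaw (PMF.pure s) π).toMeasure) (κ := κ)
  have hf : Measurable f := Measurable.of_discrete
  have hm : Measurable (Preorder.frestrictLe (π := fun _ : ℕ => S × A) t) := by fun_prop
  have hm2 : Measurable (fun x : ℕ → S × A =>
      (Preorder.frestrictLe (π := fun _ : ℕ => S × A) t x, x (t + 1))) := by fun_prop
  have : IsProbabilityMeasure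
      ((m.trajLaw π s).map (Preorder.frestrictLe (π := fun _ : ℕ => S × A) t)) :=
    Measure.isProbabilityMeasure_map hm.aemeasurable
  calc ∫ ω, f (ω (t + 1)) ∂(m.trajLaw π s)
      = ∫ p, f p.2 ∂((m.trajLaw π s).map
        (fun x => (Preorder.frestrictLe (π := fun _ : ℕ => S × A) t x, x (t + 1)))) :=
        (integral_map (f := fun p : ((i : Finset.Iic t) → S × A) × (S × A) => f p.2)
          hm2.aemeasurable (hf.comp measurable_snd).aestronglyMeasurable).symm
    _ = ∫ x, ∫ y, f y ∂(κ t x)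
          ∂((m.trajLaw π s).map (Preorder.frestrictLe (π := fun _ : ℕ => S × A) t)) := by
        rw [← key, Measure.integral_compProd]
        exact Integrable.of_bound (C := ‖f‖) (hf.comp measurable_snd).aestronglyMeasurable
          (ae_of_all _ fun p => norm_le_pi_norm f p.2)
    _ = ∫ x, m.nextExp (π.avg fun s a => f (s, a)) (x ⟨t, Finset.mem_Iic.2 le_rfl⟩).1
          (x ⟨t, Finset.mem_Iic.2 le_rfl⟩).2
          ∂((m.trajLaw π s).map (Preorder.frestrictLe (π := fun _ : ℕ => S × A) t)) := by
        refine integral_congr_ae (ae_of_all _ fun x => ?_)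
        exact integral_pairLaw _ π f
    _ = _ := by
        rw [integral_map hm.aemeasurable]
        · rfl
        · exact ((Measurable.of_discrete
            (f := fun x : S × A => m.nextExp (π.avg fun s a => f (s, a)) x.1 x.2)).comp
            (measurable_pi_apply _)).aestronglyMeasurable

theorem integral_apply (π : Policy S A) (s : S) (f : S × A → ℝ) (t : ℕ) :
    ∫ ω, f (ω t) ∂(m.trajLaw π s) = ((m.policyOp π) ^ t) (π.avg fun s a => f (s, a)) s := by
  induction t generalizing f with
  | zero => exact m.integral_apply_zero π s f
  | succ t ih =>
    rw [m.integral_apply_succ π s f t,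
      ih (fun x => m.nextExp (π.avg fun s a => f (s, a)) x.1 x.2), pow_succ, Module.End.mul_apply]
    rfl

end Expectations

end FiniteMDP

/-! ### Discounted value, gain and bias of a policy. -/

namespace FiniteMDP

section Operators

variable {S A : Type*} (m : FiniteMDP S A)

theorem abs_r_le (s : S) (a : A) : |m.r s a| ≤ 1 :=
  abs_le.2 ⟨by linarith [(m.r_mem s a).1], (m.r_mem s a).2⟩

variable [Fintype A]

theorem abs_avg_r_le (π : Policy S A) (s : S) : |π.avg m.r s| ≤ 1 :=
  abs_le.2 ⟨π.le_avg fun a => (abs_le.1 (m.abs_r_le s a)).1, π.avg_le fun a => (m.r_mem s a).2⟩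

variable [Fintype S]

theorem policyOp_eq_sum (π : Policy S A) (v : S → ℝ) (s : S) :
    m.policyOp π v s = ∑ a, ∑ s', (π s a).toReal * ((m.P s a s').toReal * v s') := by
  simp only [policyOp_apply, Policy.avg, nextExp, Finset.mul_sum]

theorem policyOp_tsum (π : Policy S A) {f : ℕ → S → ℝ} (hf : ∀ s, Summable fun t => f t s)
    (s : S) : m.policyOp π (fun s => ∑' t, f t s) s = ∑' t, m.policyOp π (f t) s := by
  simp only [policyOp_eq_sum, ← tsum_mul_left]
  have h : ∀ a s', Summable fun t => (π s a).toReal * ((m.P s a s').toReal * f t s') :=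
    fun a s' => ((hf s').mul_left _).mul_left _
  rw [Summable.tsum_finsetSum fun a _ => summable_sum fun s' _ => h a s']
  exact Finset.sum_congr rfl fun a _ => (Summable.tsum_finsetSum fun s' _ => h a s').symm

/-- The total of a summable potential satisfies the one-step equation. -/
theorem tsum_pow_eq (π : Policy S A) {f : ℕ → S → ℝ} (hf : ∀ s, Summable fun t => f t s) (c : ℝ)
    (h : ∀ t, f (t + 1) = c • m.policyOp π (f t)) (s : S) :
    ∑' t, f t s = f 0 s + c * m.policyOp π (fun s => ∑' t, f t s) s := by
  rw [(hf s).tsum_eq_zero_add, m.policyOp_tsum π hf, ← tsum_mul_left]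
  congr 1
  exact tsum_congr fun t => by rw [h t]; rfl

theorem summable_discount {γ : ℝ} (hγ : 0 ≤ γ) (hγ' : γ < 1) (π : Policy S A) (s : S) :
    Summable fun t : ℕ => γ ^ t * ((m.policyOp π) ^ t) (π.avg m.r) s := by
  refine Summable.of_norm_bounded (summable_geometric_of_lt_one hγ hγ') fun t => ?_
  rw [norm_mul, norm_pow, Real.norm_of_nonneg hγ]
  refine mul_le_of_le_one_right (pow_nonneg hγ t) ?_
  have hM := (m.isMarkovOp_policyOp π).pow t
  exact abs_le.2 ⟨hM.le_apply (fun s => (abs_le.1 (m.abs_avg_r_le π s)).1) s,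
    hM.apply_le (fun s => (abs_le.1 (m.abs_avg_r_le π s)).2) s⟩

end Operators

section Values

variable {S A : Type*} [Fintype S] [MeasurableSpace S] [MeasurableSingletonClass S]
  [Fintype A] [MeasurableSpace A] [MeasurableSingletonClass A] (m : FiniteMDP S A)

theorem discValue_eq_tsum {γ : ℝ} (hγ : 0 ≤ γ) (hγ' : γ < 1) (π : Policy S A) (s : S) :
    m.discValue γ π s = ∑' t : ℕ, γ ^ t * ((m.policyOp π) ^ t) (π.avg m.r) s := by
  have hbd : ∀ (t : ℕ) (x : S × A), ‖γ ^ t * m.r x.1 x.2‖ ≤ γ ^ t := fun t x => by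
    rw [norm_mul, norm_pow, Real.norm_of_nonneg hγ]
    exact mul_le_of_le_one_right (pow_nonneg hγ t) (m.abs_r_le _ _)
  have hint : ∀ t : ℕ, Integrable (fun ω => γ ^ t * m.r (ω t).1 (ω t).2) (m.trajLaw π s) :=
    fun t => m.integrable_apply π s (fun x => γ ^ t * m.r x.1 x.2) t
  have hsum : Summable fun t : ℕ =>
      ∫ ω, ‖γ ^ t * m.r (ω t).1 (ω t).2‖ ∂(m.trajLaw π s) := by
    refine Summable.of_nonneg_of_le (fun t => integral_nonneg fun ω => norm_nonneg _) (fun t => ?_)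
      (summable_geometric_of_lt_one hγ hγ')
    refine (integral_mono (hint t).norm (integrable_const (γ ^ t)) fun ω => hbd t (ω t)).trans ?_
    simp
  rw [discValue, ← integral_tsum_of_summable_integral_norm hint hsum]
  refine tsum_congr fun t => ?_
  rw [integral_const_mul, m.integral_apply π s (fun x => m.r x.1 x.2)]

theorem discValue_eq {γ : ℝ} (hγ : 0 ≤ γ) (hγ' : γ < 1) (π : Policy S A) :
    m.discValue γ π = π.avg m.r + γ • m.policyOp π (m.discValue γ π) := by
  have e : m.discValue γ π = fun s => ∑' t : ℕ, (γ ^ t • ((m.policyOp π) ^ t) (π.avg m.r)) s :=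
    funext fun s => m.discValue_eq_tsum hγ hγ' π s
  ext s
  rw [e]
  refine (m.tsum_pow_eq π (f := fun t => γ ^ t • ((m.policyOp π) ^ t) (π.avg m.r))
    (fun s => m.summable_discount hγ hγ' π s) γ (fun t => ?_) s).trans ?_
  · rw [map_smul, pow_succ' (m.policyOp π), Module.End.mul_apply, smul_smul, pow_succ']
  · simp

theorem discValue_le {γ : ℝ} (hγ : 0 ≤ γ) (hγ' : γ < 1) [Nonempty S] (π : Policy S A) (s : S) :
    m.discValue γ π s ≤ 1 / (1 - γ) := by
  refine (m.isMarkovOp_policyOp π).le_of_le_discount hγ hγ' (fun s => ?_) s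
  have h := congrFun (m.discValue_eq hγ hγ' π) s
  simp only [Pi.add_apply, Pi.smul_apply, smul_eq_mul] at h
  linarith [(abs_le.1 (m.abs_avg_r_le π s)).2]

/-- A real supremum is meaningful only for a family bounded above; here rewards at most `1` supply
the bound. -/
theorem discValue_le_optDiscValue {γ : ℝ} (hγ : 0 ≤ γ) (hγ' : γ < 1) [Nonempty S]
    (π : Policy S A) (s : S) : m.discValue γ π s ≤ m.optDiscValue γ s :=
  le_ciSup (f := fun π => m.discValue γ π s)
    ⟨1 / (1 - γ), by rintro _ ⟨π, rfl⟩; exact m.discValue_le hγ hγ' π s⟩ π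

theorem integral_sum_r (π : Policy S A) (s : S) (n : ℕ) :
    ∫ ω, ∑ t ∈ Finset.range n, m.r (ω t).1 (ω t).2 ∂(m.trajLaw π s) =
      ∑ t ∈ Finset.range n, ((m.policyOp π) ^ t) (π.avg m.r) s := by
  rw [integral_finsetSum _ fun t _ => m.integrable_apply π s (fun x => m.r x.1 x.2) t]
  exact Finset.sum_congr rfl fun t _ => m.integral_apply π s (fun x => m.r x.1 x.2) t

/-- This shows that the limit defining the gain exists, so that `limUnder` is not a default value.
-/
theorem gain_eq_of_decomp (π : Policy S A) {u w : S → ℝ} (hu : m.policyOp π u = u)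
    (h : π.avg m.r = u + (w - m.policyOp π w)) : m.gain π = u := by
  ext s
  rw [gain]
  refine Tendsto.limUnder_eq ?_
  simp only [integral_sum_r, h]
  exact (m.isMarkovOp_policyOp π).tendsto_average hu w s

/-- The evaluation equations: the gain is invariant, and the bias is a coboundary that solves the
Poisson equation. -/
theorem exists_gain_bias (π : Policy S A) : m.policyOp π (m.gain π) = m.gain π ∧
    π.avg m.r = m.gain π + (m.bias π - m.policyOp π (m.bias π)) ∧
      ∃ y, m.bias π = y - m.policyOp π y := by
  have hP := m.isMarkovOp_policyOp π
  obtain ⟨u, w, hu, hw⟩ := hP.exists_decomp (π.avg m.r)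
  obtain ⟨u', y, hu', hy⟩ := hP.exists_decomp w
  have hg : m.gain π = u := m.gain_eq_of_decomp π hu hw
  have hb : m.bias π = y - m.policyOp π y := by
    ext s
    rw [bias, cesaroLim]
    refine Tendsto.limUnder_eq ?_
    -- Centred rewards form the coboundary of `w`, so partial sums telescope. Their Cesàro limit
    -- removes from `w` its invariant part `u'`, leaving `y - P y`.
    have hT : ∀ T : ℕ, ∫ ω, ∑ t ∈ Finset.range T, (m.r (ω t).1 (ω t).2 - m.gain π (ω t).1)
        ∂(m.trajLaw π s) = w s - ((m.policyOp π) ^ T) w s := fun T => by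
      rw [integral_finsetSum _ fun t _ =>
        m.integrable_apply π s (fun x => m.r x.1 x.2 - m.gain π x.1) t]
      have h1 : (π.avg fun s a => m.r s a - m.gain π s) = w - m.policyOp π w := by
        have : (π.avg fun s a => m.r s a - m.gain π s) = π.avg m.r - m.gain π := by
          ext s
          rw [Pi.sub_apply, ← π.avg_const (m.gain π) s]
          simp only [Policy.avg, mul_sub, Finset.sum_sub_distrib]
        rw [this, hg, hw, add_sub_cancel_left]
      have h2 := congrFun (IsMarkovOp.sum_pow_sub (P := m.policyOp π) w T) s
      rw [Finset.sum_apply, Pi.sub_apply] at h2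
      rw [← h2]
      refine Finset.sum_congr rfl fun t _ => ?_
      rw [m.integral_apply π s (fun x => m.r x.1 x.2 - m.gain π x.1), h1]
    simp only [hT]
    have h3 := hP.tendsto_average hu' (m.policyOp π y) s
    have h4 : (y - m.policyOp π y) s = w s - u' s := by
      conv_rhs => rw [hy]
      simp
    rw [h4]
    refine (tendsto_const_nhds.sub h3).congr' ?_
    filter_upwards [eventually_gt_atTop 0] with n hn
    have hn' : (n : ℝ) ≠ 0 := Nat.cast_ne_zero.2 hn.ne'
    have h5 : u' + (m.policyOp π y - m.policyOp π (m.policyOp π y)) = m.policyOp π w := by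
      conv_rhs => rw [hy]
      rw [map_add, map_sub, hu']
    -- The Cesàro mean starts at `T = 1`; the shift is absorbed by averaging `P w` instead of `w`,
    -- which has the same invariant part.
    have h6 : ∑ T ∈ Finset.Icc 1 n, ((m.policyOp π) ^ T) w s =
        ∑ t ∈ Finset.range n, ((m.policyOp π) ^ t) (m.policyOp π w) s := by
      rw [← Finset.Ico_add_one_right_eq_Icc, Finset.sum_Ico_eq_sum_range]
      refine Finset.sum_congr rfl fun t _ => ?_
      rw [add_comm, pow_succ, Module.End.mul_apply]
    rw [h5, Finset.sum_sub_distrib, h6, Finset.sum_const, Nat.card_Icc]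
    simp only [Nat.add_sub_cancel, nsmul_eq_mul]
    field_simp
  refine ⟨by rw [hg, hu], ?_, y, hb⟩
  have h7 : w - m.policyOp π w = m.bias π - m.policyOp π (m.bias π) := by
    conv_lhs => rw [hy]
    rw [hb, map_add, hu', add_sub_add_left_eq_sub]
  rw [hg, ← h7, ← hw]

theorem policyOp_gain (π : Policy S A) : m.policyOp π (m.gain π) = m.gain π :=
  (m.exists_gain_bias π).1

theorem avg_r_eq_gain_add_bias (π : Policy S A) :
    π.avg m.r = m.gain π + (m.bias π - m.policyOp π (m.bias π)) :=
  (m.exists_gain_bias π).2.1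

theorem gain_mem (π : Policy S A) (s : S) : m.gain π s ∈ Set.Icc (0 : ℝ) 1 := by
  have hP := m.isMarkovOp_policyOp π
  have h := hP.tendsto_average (m.policyOp_gain π) (m.bias π) s
  rw [← m.avg_r_eq_gain_add_bias] at h
  refine ⟨ge_of_tendsto' h fun n => div_nonneg (Finset.sum_nonneg fun t _ =>
    (hP.pow t).le_apply (fun s => π.le_avg fun a => (m.r_mem s a).1) s) (Nat.cast_nonneg n),
    le_of_tendsto' h fun n => div_le_one_of_le₀ ?_ (Nat.cast_nonneg n)⟩
  refine (Finset.sum_le_card_nsmul _ _ 1 fun t _ =>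
    (hP.pow t).apply_le (fun s => π.avg_le fun a => (m.r_mem s a).2) s).trans ?_
  simp

theorem gain_le_optGain (π : Policy S A) (s : S) : m.gain π s ≤ m.optGain s :=
  le_ciSup (f := fun π => m.gain π s) ⟨1, by rintro _ ⟨π, rfl⟩; exact (m.gain_mem π s).2⟩ π

theorem optGain_mem [Nonempty A] (s : S) : m.optGain s ∈ Set.Icc (0 : ℝ) 1 := by
  have : Nonempty (Policy S A) := ⟨fun _ => PMF.pure (Classical.arbitrary A)⟩
  exact ⟨Real.iSup_nonneg fun π => (m.gain_mem π s).1, ciSup_le fun π => (m.gain_mem π s).2⟩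

/-- The Laurent expansion of the discounted value at discount factor `1`. -/
theorem exists_discValue_sub_le [Nonempty S] (π : Policy S A) :
    ∃ C, ∀ γ : ℝ, 0 ≤ γ → γ < 1 → ∀ s,
      |m.discValue γ π s - (m.gain π s / (1 - γ) + m.bias π s)| ≤ (1 - γ) * C := by
  obtain ⟨hu, hr, y, hy⟩ := m.exists_gain_bias π
  refine ⟨2 * ‖m.policyOp π y‖, fun γ hγ hγ' s => ?_⟩
  rw [hy] at hr ⊢
  refine ((m.isMarkovOp_policyOp π).abs_resolvent_sub_le hγ hγ' hu hr
    (m.discValue_eq hγ hγ' π) s).trans_eq (by ring)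

end Values

end FiniteMDP

/-! ### Blackwell optimality through expansions in `ε = 1 - γ`. -/

theorem le_of_forall_small_le {a b k c ε₀ : ℝ} (hε₀ : 0 < ε₀)
    (h : ∀ ε, 0 < ε → ε < ε₀ → a ≤ b + ε * k + ε ^ 2 * c) : a ≤ b := by
  have h1 : Tendsto (fun ε : ℝ => b + ε * k + ε ^ 2 * c) (𝓝[>] 0) (𝓝 b) := by
    have h2 : Continuous fun ε : ℝ => b + ε * k + ε ^ 2 * c := by fun_prop
    have h3 := h2.tendsto 0
    simp only [zero_mul, add_zero, ne_eq, OfNat.ofNat_ne_zero, not_false_eq_true, zero_pow] at h3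
    exact h3.mono_left nhdsWithin_le_nhds
  refine ge_of_tendsto h1 ?_
  filter_upwards [Ioo_mem_nhdsGT hε₀] with ε hε using h ε hε.1 hε.2

section Span

variable {S : Type*} [Fintype S] [Nonempty S]

theorem sub_le_spanSeminorm (v : S → ℝ) (s s' : S) : v s - v s' ≤ spanSeminorm v :=
  sub_le_sub (Finset.le_sup' v (Finset.mem_univ s)) (Finset.inf'_le v (Finset.mem_univ s'))

theorem spanSeminorm_nonneg (v : S → ℝ) : 0 ≤ spanSeminorm v := by
  simpa using sub_le_spanSeminorm v (Classical.arbitrary S) (Classical.arbitrary S)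

end Span

namespace FiniteMDP

theorem sub_policyOp_eq_avg {S A : Type*} [Fintype S] [Fintype A] (m : FiniteMDP S A)
    (π : Policy S A) (v : S → ℝ) (s : S) :
    (v - m.policyOp π v) s = π.avg (fun s a => v s - m.nextExp v s a) s := by
  rw [Pi.sub_apply, policyOp_apply, ← π.avg_const v s]
  simp only [Policy.avg, mul_sub, Finset.sum_sub_distrib]

section Blackwell

variable {S A : Type*} [Fintype S] [Nonempty S] [MeasurableSpace S] [MeasurableSingletonClass S]
  [Fintype A] [MeasurableSpace A] [MeasurableSingletonClass A] (m : FiniteMDP S A)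

/-- The value function of a discounted optimal policy satisfies the optimality inequality. -/
theorem r_add_nextExp_discValue_le {γ : ℝ} (hγ : 0 ≤ γ) (hγ' : γ < 1) {π : Policy S A}
    (h : m.discValue γ π = m.optDiscValue γ) (s : S) (a : A) :
    m.r s a + γ * m.nextExp (m.discValue γ π) s a ≤ m.discValue γ π s := by
  classical
  by_contra! hlt
  -- Policy improvement: changing `π` only at `s` would give a value nowhere smaller and strictly
  -- larger at `s`.
  set π' : Policy S A := Function.update π s (PMF.pure a) with hπ'
  have havg : ∀ f : S → A → ℝ, π'.avg f s = f s a := fun f => by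
    rw [← Policy.avg_det (fun _ => a) f s]
    simp [Policy.avg, hπ', Policy.det]
  have havg' : ∀ (f : S → A → ℝ) (s'), s' ≠ s → π'.avg f s' = π.avg f s' := fun f s' hs' => by
    simp [Policy.avg, hπ', Function.update_of_ne hs']
  have e := fun s => congrFun (m.discValue_eq hγ hγ' π) s
  have e' := fun s => congrFun (m.discValue_eq hγ hγ' π') s
  simp only [Pi.add_apply, Pi.smul_apply, smul_eq_mul] at e e'
  have himp : ∀ s', m.discValue γ π s' ≤
      π'.avg m.r s' + γ * m.policyOp π' (m.discValue γ π) s' := fun s' => by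
    by_cases hs' : s' = s
    · subst hs'
      rw [policyOp_apply, havg, havg]
      exact hlt.le
    · rw [policyOp_apply, havg' _ _ hs', havg' _ _ hs']
      exact (e s').le
  have hle : ∀ s', (m.discValue γ π - m.discValue γ π') s' ≤ 0 / (1 - γ) :=
    (m.isMarkovOp_policyOp π').le_of_le_discount hγ hγ' fun s' => by
      rw [map_sub]
      simp only [Pi.sub_apply]
      linarith [himp s', e' s']
  have hle' : m.discValue γ π ≤ m.discValue γ π' := fun s' => by
    have := hle s'
    rw [zero_div, Pi.sub_apply] at this
    linarith
  have h1 := e' s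
  rw [policyOp_apply, havg, havg] at h1
  have h2 := mul_le_mul_of_nonneg_left (m.nextExp_mono hle' s a) hγ
  have h3 := m.discValue_le_optDiscValue hγ hγ' π' s
  rw [← h] at h3
  linarith

variable {m} {π : Policy S A}

omit [Nonempty S] in
theorem IsBlackwellOptimal.exists_forall_small (hB : m.IsBlackwellOptimal π) :
    ∃ ε₀ > 0, ∀ ε, 0 < ε → ε < ε₀ →
      0 ≤ 1 - ε ∧ 1 - ε < 1 ∧ m.discValue (1 - ε) π = m.optDiscValue (1 - ε) := by
  obtain ⟨γ₀, hγ₀, h⟩ := hB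
  refine ⟨min 1 (1 - γ₀), lt_min one_pos (sub_pos.2 hγ₀), fun ε hε hε' => ?_⟩
  have h1 := hε'.trans_le (min_le_left _ _)
  have h2 := hε'.trans_le (min_le_right _ _)
  exact ⟨by linarith, by linarith, h _ (by linarith) (by linarith) (by linarith)⟩

/-- A Blackwell optimal policy is gain optimal. -/
theorem IsBlackwellOptimal.gain_eq (hB : m.IsBlackwellOptimal π) : m.gain π = m.optGain := by
  obtain ⟨ε₀, hε₀, h⟩ := hB.exists_forall_small
  obtain ⟨C, hC⟩ := m.exists_discValue_sub_le π
  ext s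
  refine le_antisymm (m.gain_le_optGain π s) ?_
  have : Nonempty (Policy S A) := ⟨π⟩
  refine ciSup_le fun π' => ?_
  obtain ⟨C', hC'⟩ := m.exists_discValue_sub_le π'
  -- After multiplication by `ε` the gains are the leading terms; the biases enter at order `ε` and
  -- the errors at order `ε ^ 2`.
  refine le_of_forall_small_le (k := m.bias π s - m.bias π' s) (c := C + C') hε₀
    fun ε hε hε' => ?_
  obtain ⟨h0, h1, hopt⟩ := h ε hε hε'
  have h2 := m.discValue_le_optDiscValue h0 h1 π' s
  rw [← hopt] at h2
  have h3 := (abs_le.1 (hC _ h0 h1 s)).2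
  have h4 := (abs_le.1 (hC' _ h0 h1 s)).1
  rw [sub_sub_cancel] at h3 h4
  have h5 : m.gain π' s / ε ≤ m.gain π s / ε + (m.bias π s - m.bias π' s) + ε * (C + C') := by
    linarith
  have h6 := mul_le_mul_of_nonneg_left h5 hε.le
  rw [mul_div_cancel₀ _ hε.ne', mul_add, mul_add, mul_div_cancel₀ _ hε.ne'] at h6
  linarith

/-- The bias of a Blackwell optimal policy satisfies the optimality inequality for all actions
that preserve the optimal gain. -/
theorem IsBlackwellOptimal.r_add_nextExp_bias_le (hB : m.IsBlackwellOptimal π) {s : S} {a : A}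
    (ha : m.nextExp m.optGain s a = m.optGain s) :
    m.r s a + m.nextExp (m.bias π) s a ≤ m.optGain s + m.bias π s := by
  obtain ⟨ε₀, hε₀, h⟩ := hB.exists_forall_small
  obtain ⟨C, hC⟩ := m.exists_discValue_sub_le π
  rw [hB.gain_eq] at hC
  refine le_of_forall_small_le (k := 2 * C + m.nextExp (m.bias π) s a) (c := -C) hε₀
    fun ε hε hε' => ?_
  obtain ⟨h0, h1, hopt⟩ := h ε hε hε'
  have h2 := m.r_add_nextExp_discValue_le h0 h1 hopt s a
  have h3 := (abs_le.1 (hC _ h0 h1 s)).2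
  have h4 : m.nextExp (fun s => (ε⁻¹ * m.optGain s + m.bias π s) + -(ε * C)) s a ≤
      m.nextExp (m.discValue (1 - ε) π) s a := m.nextExp_mono (fun s => by
    have := (abs_le.1 (hC _ h0 h1 s)).1
    rw [sub_sub_cancel, div_eq_inv_mul] at this
    linarith) s a
  rw [nextExp_add, nextExp_add, nextExp_mul, nextExp_const, ha] at h4
  rw [sub_sub_cancel, div_eq_inv_mul] at h3
  have h5 := mul_le_mul_of_nonneg_left h4 h0
  -- Since `a` preserves `ρ*`, the singular terms cancel and leave exactly `ρ*` at order zero.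
  have h6 : (1 - ε) * (ε⁻¹ * m.optGain s + m.nextExp (m.bias π) s a + -(ε * C)) =
      ε⁻¹ * m.optGain s - m.optGain s + (1 - ε) * (m.nextExp (m.bias π) s a + -(ε * C)) := by
    field_simp
    ring
  rw [h6] at h5
  linarith

end Blackwell

/-! ### Finiteness of the gain-dropping times. -/

section Drop

variable {S A : Type*} [Fintype S] [MeasurableSpace S] [MeasurableSingletonClass S]
  [Fintype A] [MeasurableSpace A] [MeasurableSingletonClass A] (m : FiniteMDP S A)

/-- The probability of taking a gain-dropping action. -/
noncomputable def dropProb (π : Policy S A) : S → ℝ :=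
  π.avg fun s a => m.dropSet.indicator 1 (s, a)

/-- The expected number of gain-dropping actions. -/
noncomputable def dropSum (π : Policy S A) (s : S) : ℝ :=
  ∑' t : ℕ, ((m.policyOp π) ^ t) (m.dropProb π) s

theorem dropProb_nonneg (π : Policy S A) : 0 ≤ m.dropProb π := fun _ =>
  π.le_avg fun _ => Set.indicator_nonneg (fun _ _ => zero_le_one) _

theorem pow_dropProb_nonneg (π : Policy S A) (t : ℕ) :
    0 ≤ ((m.policyOp π) ^ t) (m.dropProb π) :=
  ((m.isMarkovOp_policyOp π).pow t).nonneg _ (m.dropProb_nonneg π)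

theorem dropSum_nonneg (π : Policy S A) : 0 ≤ m.dropSum π := fun s =>
  tsum_nonneg fun t => m.pow_dropProb_nonneg π t s

/-- There are finitely many pairs, so the strict drops have a positive minimum. -/
theorem exists_drop_gap : ∃ ε > 0, ∀ x ∈ m.dropSet,
    ε ≤ m.optGain x.1 - m.nextExp m.optGain x.1 x.2 := by
  rcases m.dropSet.eq_empty_or_nonempty with h | h
  · exact ⟨1, one_pos, by simp [h]⟩
  · obtain ⟨x, hx, hmin⟩ := Set.exists_min_image m.dropSet
      (fun x => m.optGain x.1 - m.nextExp m.optGain x.1 x.2) (Set.toFinite _) h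
    exact ⟨_, sub_pos.2 hx, hmin⟩

variable [Nonempty A]

/-- The expected numbers of gain-dropping actions are bounded, uniformly in the policy. -/
theorem exists_sum_dropProb_le (hρ : ∀ s a, m.nextExp m.optGain s a ≤ m.optGain s) :
    ∃ C, ∀ (π : Policy S A) (n : ℕ) (s : S),
      ∑ t ∈ Finset.range n, ((m.policyOp π) ^ t) (m.dropProb π) s ≤ C := by
  obtain ⟨ε, hε, hgap⟩ := m.exists_drop_gap
  refine ⟨1 / ε, fun π n s => ?_⟩
  rw [le_div_iff₀' hε]
  -- Every drop costs at least `ε` of `ρ*`, while the total expected loss telescopes to at most `1`.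
  have h1 : ε • m.dropProb π ≤ m.optGain - m.policyOp π m.optGain := fun s => by
    rw [sub_policyOp_eq_avg]
    simp only [Pi.smul_apply, dropProb, Policy.avg, smul_eq_mul, Finset.mul_sum]
    refine Finset.sum_le_sum fun a _ => ?_
    rw [mul_left_comm]
    refine mul_le_mul_of_nonneg_left ?_ ENNReal.toReal_nonneg
    by_cases hx : (s, a) ∈ m.dropSet
    · simpa [hx] using hgap _ hx
    · simpa [hx] using hρ s a
  have h2 := congrFun (IsMarkovOp.sum_pow_sub (P := m.policyOp π) m.optGain n) s
  rw [Finset.sum_apply, Pi.sub_apply] at h2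
  calc ε * ∑ t ∈ Finset.range n, ((m.policyOp π) ^ t) (m.dropProb π) s
      ≤ ∑ t ∈ Finset.range n,
          ((m.policyOp π) ^ t) (m.optGain - m.policyOp π m.optGain) s := by
        rw [Finset.mul_sum]
        refine Finset.sum_le_sum fun t _ => ?_
        have := ((m.isMarkovOp_policyOp π).pow t).mono h1 s
        rwa [map_smul] at this
    _ ≤ 1 := by
        rw [h2]
        linarith [(m.optGain_mem s).2, ((m.isMarkovOp_policyOp π).pow n).le_apply
          (fun s => (m.optGain_mem s).1) s]

variable {m} (hρ : ∀ s a, m.nextExp m.optGain s a ≤ m.optGain s)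
include hρ

theorem summable_dropProb (π : Policy S A) (s : S) :
    Summable fun t : ℕ => ((m.policyOp π) ^ t) (m.dropProb π) s := by
  obtain ⟨C, hC⟩ := exists_sum_dropProb_le m hρ
  exact summable_of_sum_range_le (fun t => m.pow_dropProb_nonneg π t s) fun n => hC π n s

theorem dropTime_eq (π : Policy S A) : m.dropTime π = ⨆ s, ENNReal.ofReal (m.dropSum π s) := by
  refine iSup_congr fun s => ?_
  have hmeas : Measurable (m.dropSet.indicator (1 : S × A → ℝ≥0∞)) := Measurable.of_discrete
  refine (lintegral_tsum (f := fun t (ω : ℕ → S × A) =>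
    m.dropSet.indicator (1 : S × A → ℝ≥0∞) (ω t))
    fun t => (hmeas.comp (measurable_pi_apply t)).aemeasurable).trans ?_
  rw [dropSum,
    ENNReal.ofReal_tsum_of_nonneg (fun t => m.pow_dropProb_nonneg π t s) (summable_dropProb hρ π s)]
  refine tsum_congr fun t => ?_
  rw [show m.dropProb π = π.avg fun s a => m.dropSet.indicator (1 : S × A → ℝ) (s, a) from rfl,
    ← m.integral_apply π s (m.dropSet.indicator 1),
    ofReal_integral_eq_lintegral_ofReal
      (m.integrable_apply π s (m.dropSet.indicator (1 : S × A → ℝ)) t)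
      (ae_of_all _ fun ω => Set.indicator_nonneg (f := (1 : S × A → ℝ))
        (fun _ _ => zero_le_one) _)]
  refine lintegral_congr fun ω => ?_
  by_cases hx : ω t ∈ m.dropSet <;> simp [hx]

theorem exists_dropTime_le : ∃ C : ℝ, ∀ π : Policy S A, m.dropTime π ≤ ENNReal.ofReal C := by
  obtain ⟨C, hC⟩ := exists_sum_dropProb_le m hρ
  refine ⟨C, fun π => ?_⟩
  rw [dropTime_eq hρ]
  exact iSup_le fun s => ENNReal.ofReal_le_ofReal
    (Real.tsum_le_of_sum_range_le (fun t => m.pow_dropProb_nonneg π t s) fun n => hC π n s)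

theorem dropTime_ne_top (π : Policy S A) : m.dropTime π ≠ ⊤ := by
  obtain ⟨C, hC⟩ := exists_dropTime_le hρ
  exact ne_top_of_le_ne_top ENNReal.ofReal_ne_top (hC π)

theorem maxDropTime_ne_top : m.maxDropTime ≠ ⊤ := by
  obtain ⟨C, hC⟩ := exists_dropTime_le hρ
  exact ne_top_of_le_ne_top ENNReal.ofReal_ne_top (iSup_le fun f => hC _)

/-- Finiteness is essential here: `toReal` sends `⊤` to `0`. -/
theorem dropSum_le (π : Policy S A) (s : S) : m.dropSum π s ≤ (m.dropTime π).toReal := by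
  refine (ENNReal.ofReal_le_iff_le_toReal (dropTime_ne_top hρ π)).1 ?_
  rw [dropTime_eq hρ]
  exact le_iSup (fun s => ENNReal.ofReal (m.dropSum π s)) s

theorem dropSum_det_le (f : S → A) (s : S) :
    m.dropSum (Policy.det f) s ≤ m.maxDropTime.toReal :=
  (dropSum_le hρ _ s).trans (ENNReal.toReal_mono (maxDropTime_ne_top hρ)
    (le_iSup (fun f : S → A => m.dropTime (Policy.det f)) f))

theorem dropSum_eq (π : Policy S A) (s : S) :
    m.dropSum π s = m.dropProb π s + m.policyOp π (m.dropSum π) s := by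
  have := m.tsum_pow_eq π (summable_dropProb hρ π) 1
    (fun t => by rw [one_smul, pow_succ', Module.End.mul_apply]) s
  rw [one_mul] at this
  exact this

end Drop

end FiniteMDP

/-! ### Approximate fixed points and the gain of greedy policies. -/

namespace FiniteMDP

section Optimality

variable {S A : Type*} [Fintype S] [MeasurableSpace S] [MeasurableSingletonClass S]
  [Fintype A] [Nonempty A] [MeasurableSpace A] [MeasurableSingletonClass A] {m : FiniteMDP S A}

omit [MeasurableSpace S] [MeasurableSingletonClass S]
  [MeasurableSpace A] [MeasurableSingletonClass A] in
theorem evalOp_le_bellmanOp (γ : ℝ) (π : Policy S A) (V : S → ℝ) (s : S) :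
    m.evalOp γ π V s ≤ m.bellmanOp γ V s :=
  π.avg_le (f := fun s a => m.r s a + γ * m.nextExp V s a) fun a =>
    Finset.le_sup' (fun a => m.r s a + γ * m.nextExp V s a) (Finset.mem_univ a)

omit [MeasurableSpace S] [MeasurableSingletonClass S]
  [MeasurableSpace A] [MeasurableSingletonClass A] in
theorem exists_bellmanOp_eq (γ : ℝ) (V : S → ℝ) :
    ∃ f : S → A, ∀ s, m.bellmanOp γ V s = m.r s (f s) + γ * m.nextExp V s (f s) := by
  have h : ∀ s, ∃ a, m.bellmanOp γ V s = m.r s a + γ * m.nextExp V s a := fun s => by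
    obtain ⟨a, -, ha⟩ := Finset.exists_mem_eq_sup' (Finset.univ_nonempty (α := A))
      fun a => m.r s a + γ * m.nextExp V s a
    exact ⟨a, ha⟩
  exact ⟨fun s => (h s).choose, fun s => (h s).choose_spec⟩

variable [Nonempty S] {γ δ : ℝ} (hγ : 0 < γ) (hγ' : γ < 1) {V : S → ℝ}
include hγ hγ'

/-- Approximate fixed points of the discounted Bellman operator are bounded above in terms of
approximate solutions of the average-reward optimality equation, in which gain-dropping actions may
have an advantage of at most `K`. -/
theorem le_of_le_bellmanOp (hρ : ∀ s a, m.nextExp m.optGain s a ≤ m.optGain s) {h : S → ℝ}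
    {K : ℝ} (hK : 0 ≤ K)
    (hh : ∀ s a, m.r s a + m.nextExp h s a ≤
      m.optGain s + h s + K * m.dropSet.indicator 1 (s, a))
    (hV : ∀ s, V s ≤ m.bellmanOp γ V s + δ) (s : S) :
    V s ≤ m.optGain s / (1 - γ) + (spanSeminorm h + K * m.maxDropTime.toReal) + δ / (1 - γ) := by
  have h1 : 0 < 1 - γ := by linarith
  obtain ⟨f, hf⟩ := exists_bellmanOp_eq (m := m) γ V
  set P := m.policyOp (Policy.det f) with hP
  have hM : IsMarkovOp P := m.isMarkovOp_policyOp _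
  have hPa : ∀ v s, P v s = m.nextExp v s (f s) := fun v s => Policy.avg_det f _ s
  set D := m.dropSum (Policy.det f) with hD
  have hDs : ∀ s, D s = m.dropSet.indicator 1 (s, f s) + P D s := fun s => by
    rw [hD, dropSum_eq hρ, dropProb, Policy.avg_det]
  -- Shifting `h` to be nonnegative gives the leftover `(1 - γ) P (h - min h)` the sign required of
  -- a supersolution; `D ≥ 0` does the same for the drop term.
  obtain ⟨s₀, hs₀⟩ := Finite.exists_min h
  have key := hM.le_of_le_discount hγ.le hγ' (c := δ)
    (Y := V - ((1 - γ)⁻¹ • m.optGain + (h - fun _ => h s₀) + K • D)) (fun s => by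
      simp only [map_add, map_sub, map_smul, hM.const, Pi.add_apply, Pi.sub_apply, Pi.smul_apply,
        smul_eq_mul]
      have e1 : (1 - γ) * ((1 - γ)⁻¹ * m.optGain s) = m.optGain s :=
        mul_inv_cancel_left₀ h1.ne' _
      have e2 : (1 - γ)⁻¹ * P m.optGain s ≤ (1 - γ)⁻¹ * m.optGain s := by
        rw [hPa]
        exact mul_le_mul_of_nonneg_left (hρ s _) (inv_nonneg.2 h1.le)
      have e3 := mul_le_mul_of_nonneg_left e2 hγ.le
      have e4 := mul_nonneg h1.le (sub_nonneg.2 (hM.le_apply hs₀ s))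
      have e5 := mul_nonneg h1.le (mul_nonneg hK (hM.nonneg _ (m.dropSum_nonneg (Policy.det f)) s))
      have e6 := hh s (f s)
      have e7 := hV s
      have e8 : K * D s = K * m.dropSet.indicator 1 (s, f s) + K * P D s := by
        rw [← mul_add, ← hDs]
      rw [hf, ← hPa] at e7
      rw [← hPa] at e6
      linarith) s
  simp only [Pi.sub_apply, Pi.add_apply, Pi.smul_apply, smul_eq_mul] at key
  have h2 := sub_le_spanSeminorm h s s₀
  have h3 : K * D s ≤ K * m.maxDropTime.toReal :=
    mul_le_mul_of_nonneg_left (dropSum_det_le hρ f s) hK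
  rw [div_eq_inv_mul (m.optGain s)]
  linarith

/-- Approximate fixed points of the discounted Bellman operator are bounded below in terms of
subsolutions of the evaluation equation of a policy that preserves the optimal gain. -/
theorem le_of_bellmanOp_le {π : Policy S A} (hρ : m.policyOp π m.optGain = m.optGain)
    {h : S → ℝ} (hh : m.optGain + (h - m.policyOp π h) ≤ π.avg m.r)
    (hV : ∀ s, m.bellmanOp γ V s ≤ V s + δ) (s : S) :
    m.optGain s / (1 - γ) - spanSeminorm h - δ / (1 - γ) ≤ V s := by
  have h1 : 0 < 1 - γ := by linarith
  have hM := m.isMarkovOp_policyOp π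
  -- For a subsolution the leftover must be nonpositive, so the maximum of `h` is subtracted.
  obtain ⟨s₀, hs₀⟩ := Finite.exists_max h
  have key := hM.le_of_discount_le hγ.le hγ' (c := -δ)
    (Y := V - ((1 - γ)⁻¹ • m.optGain + (h - fun _ => h s₀))) (fun s => by
      simp only [map_add, map_sub, map_smul, hM.const, hρ, Pi.add_apply, Pi.sub_apply,
        Pi.smul_apply, smul_eq_mul]
      have e1 : (1 - γ) * ((1 - γ)⁻¹ * m.optGain s) = m.optGain s :=
        mul_inv_cancel_left₀ h1.ne' _
      have e4 := mul_nonneg h1.le (sub_nonneg.2 (hM.apply_le hs₀ s))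
      have e6 := hh s
      have e7 := (evalOp_le_bellmanOp γ π V s).trans (hV s)
      rw [evalOp_eq] at e7
      simp only [Pi.add_apply, Pi.sub_apply] at e6
      linarith) s
  simp only [Pi.sub_apply, Pi.add_apply, Pi.smul_apply, smul_eq_mul, neg_div] at key
  have h2 := sub_le_spanSeminorm h s₀ s
  rw [div_eq_inv_mul (m.optGain s)]
  linarith

/-- The suboptimality of a greedy policy in terms of the distance of `V` to the rescaled optimal
gain. -/
theorem optGain_sub_gain_le (hρ : ∀ s a, m.nextExp m.optGain s a ≤ m.optGain s) {π : Policy S A}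
    (hπ : m.evalOp γ π V = m.bellmanOp γ V) {B c : ℝ}
    (hB : ∀ s, |V s - m.optGain s / (1 - γ)| ≤ B) (hV : ∀ s, V s - δ ≤ m.bellmanOp γ V s)
    (hc : 0 ≤ c) (hc' : (1 - γ) * (1 + 2 * B + δ) ≤ γ * c) (s : S) :
    m.optGain s - m.gain π s ≤ c * (m.dropTime π).toReal + (1 - γ) * B + δ := by
  have h1 : 0 < 1 - γ := by linarith
  set R : S → ℝ := fun s => (1 - γ)⁻¹ * m.optGain s with hR
  have hRs : ∀ s, (1 - γ) * R s = m.optGain s := fun s => mul_inv_cancel_left₀ h1.ne' _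
  have hBR : ∀ s, V s ≤ R s + B ∧ R s - B ≤ V s := fun s => by
    have := abs_le.1 (hB s)
    rw [div_eq_inv_mul] at this
    constructor <;> simp only [hR] <;> linarith [this.1, this.2]
  have hM := m.isMarkovOp_policyOp π
  have hB0 : 0 ≤ B := (abs_nonneg _).trans (hB (Classical.arbitrary S))
  have hdrop : ∀ s a, π s a ≠ 0 → m.optGain s - m.nextExp m.optGain s a ≤ c := fun s a ha => by
    have e1 : m.r s a + γ * m.nextExp V s a = m.bellmanOp γ V s :=
      π.eq_of_avg_eq (f := fun s a => m.r s a + γ * m.nextExp V s a)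
        (fun a => Finset.le_sup' (fun a => m.r s a + γ * m.nextExp V s a) (Finset.mem_univ a))
        (congrFun hπ s) ha
    have e2 : m.nextExp V s a ≤ (1 - γ)⁻¹ * m.nextExp m.optGain s a + B := by
      have := m.nextExp_mono (w := fun s => R s + B) (fun s => (hBR s).1) s a
      rwa [nextExp_add, nextExp_mul, nextExp_const] at this
    have e3 := mul_le_mul_of_nonneg_left e2 hγ.le
    have e4 : R s - γ * ((1 - γ)⁻¹ * m.nextExp m.optGain s a) ≤ 1 + 2 * B + δ := by
      have e5 : γ * B ≤ B := mul_le_of_le_one_left hB0 hγ'.le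
      linarith [hV s, (hBR s).2, (m.r_mem s a).2]
    have e6 := mul_le_mul_of_nonneg_left e4 h1.le
    rw [mul_sub, hRs, mul_left_comm, mul_inv_cancel_left₀ h1.ne'] at e6
    -- `ρ* - γ P ρ* = (1 - γ) ρ* + γ (ρ* - P ρ*)`, and the first term is nonnegative.
    have e7 := mul_nonneg h1.le (m.optGain_mem s).1
    by_contra! hlt
    have := mul_lt_mul_of_pos_left hlt hγ
    linarith
  have hdrop' : ∀ s, (m.optGain - m.policyOp π m.optGain) s ≤ c * m.dropProb π s := fun s => by
    rw [sub_policyOp_eq_avg]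
    simp only [dropProb, Policy.avg, Finset.mul_sum]
    refine Finset.sum_le_sum fun a _ => ?_
    rw [mul_left_comm]
    by_cases ha : π s a = 0
    · simp [ha]
    · refine mul_le_mul_of_nonneg_left ?_ ENNReal.toReal_nonneg
      by_cases hx : (s, a) ∈ m.dropSet
      · simpa [hx] using hdrop s a ha
      · rw [Set.indicator_of_notMem hx, mul_zero]
        exact sub_nonpos.2 (not_lt.1 hx)
  -- The recursion for `dropSum` pays for every loss of `ρ*`, so the left side is subinvariant. The
  -- coboundary of `γ • V - bias` comes from combining the greedy and Poisson equations.
  have key : (m.optGain - c • m.dropSum π - fun _ => (1 - γ) * B + δ) ≤ m.gain π := by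
    refine hM.le_of_fixed_of_le (x := γ • V - m.bias π) (m.policyOp_gain π) (fun s => ?_)
      fun s => ?_
    · have e1 := hdrop' s
      have e2 := congrArg (c * ·) (dropSum_eq hρ π s)
      simp only [map_sub, map_smul, hM.const, Pi.sub_apply, Pi.smul_apply, smul_eq_mul,
        mul_add] at e1 e2 ⊢
      linarith
    · have e1 := congrFun (m.avg_r_eq_gain_add_bias π) s
      have e2 := congrFun hπ s
      have e3 := mul_le_mul_of_nonneg_left (hBR s).2 h1.le
      have e4 : 0 ≤ c * m.dropSum π s := mul_nonneg hc (m.dropSum_nonneg π s)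
      rw [evalOp_eq] at e2
      rw [mul_sub, hRs] at e3
      simp only [map_sub, map_smul, Pi.add_apply, Pi.sub_apply, Pi.smul_apply,
        smul_eq_mul] at e1 ⊢
      linarith [hV s]
  have h2 := key s
  have h3 := mul_le_mul_of_nonneg_left (dropSum_le hρ π s) hc
  simp only [Pi.sub_apply, Pi.smul_apply, smul_eq_mul] at h2
  linarith

/-- Bounded distance to the rescaled optimal gain, from a solution of both the modified and the
unmodified optimality equations. -/
theorem abs_sub_optGain_le_of_bellman {h : S → ℝ} (h_mod : m.ModifiedBellman m.optGain h)
    (h_unmod : m.UnmodifiedBellman m.optGain h)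
    (hV : ∀ s, |m.bellmanOp γ V s - V s| ≤ δ) (s : S) :
    |V s - m.optGain s / (1 - γ)| ≤ spanSeminorm h + δ / (1 - γ) := by
  have hup := le_of_le_bellmanOp (m := m) hγ hγ' (δ := δ) (V := V) (h := h)
    (fun s a => (h_mod.1 s).2 ⟨a, rfl⟩) le_rfl
    (fun s a => by
      rw [zero_mul, add_zero]
      exact (h_mod.2 s).2 ⟨a, rfl⟩)
    (fun s => by linarith [(abs_le.1 (hV s)).1]) s
  -- The unmodified equation attains its maximum at an action that also preserves `ρ*`, so one
  -- selector meets both requirements.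
  choose f hf hf' using fun s => (h_unmod.2 s).1
  have hlo := le_of_bellmanOp_le (m := m) hγ hγ' (δ := δ) (V := V) (h := h) (π := Policy.det f)
    (funext fun s => by rw [policyOp_apply, Policy.avg_det]; exact hf s)
    (fun s => by
      have := hf' s
      simp only [Pi.add_apply, Pi.sub_apply, policyOp_apply, Policy.avg_det] at this ⊢
      linarith)
    (fun s => by linarith [(abs_le.1 (hV s)).2]) s
  rw [abs_le]
  constructor <;> linarith

/-- Bounded distance to the rescaled optimal gain, from a Blackwell optimal policy. -/
theorem abs_sub_optGain_le_of_blackwell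
    (hρ : ∀ s a, m.nextExp m.optGain s a ≤ m.optGain s)
    {π : Policy S A} (hB : m.IsBlackwellOptimal π)
    (hV : ∀ s, |m.bellmanOp γ V s - V s| ≤ δ) (s : S) :
    |V s - m.optGain s / (1 - γ)| ≤ spanSeminorm (m.bias π) + m.maxDropTime.toReal +
      spanSeminorm (m.bias π) * m.maxDropTime.toReal + δ / (1 - γ) := by
  have hsp := spanSeminorm_nonneg (m.bias π)
  have hT : 0 ≤ m.maxDropTime.toReal := ENNReal.toReal_nonneg
  -- At a dropping action the advantage is at most one reward plus one span of the bias; this is the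
  -- value of `K`.
  have hup := le_of_le_bellmanOp (m := m) hγ hγ' (δ := δ) (V := V) (h := m.bias π)
    (K := 1 + spanSeminorm (m.bias π)) hρ (by linarith)
    (fun s a => by
      by_cases hx : (s, a) ∈ m.dropSet
      · obtain ⟨s₁, hs₁⟩ := Finite.exists_max (m.bias π)
        have e1 := m.nextExp_le hs₁ s a
        have e2 := sub_le_spanSeminorm (m.bias π) s₁ s
        rw [Set.indicator_of_mem hx, Pi.one_apply, mul_one]
        linarith [(m.r_mem s a).2, (m.optGain_mem s).1]
      · rw [Set.indicator_of_notMem hx, mul_zero, add_zero]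
        exact hB.r_add_nextExp_bias_le (le_antisymm (hρ s a) (not_lt.1 hx)))
    (fun s => by linarith [(abs_le.1 (hV s)).1]) s
  have hlo := le_of_bellmanOp_le (m := m) hγ hγ' (δ := δ) (V := V) (h := m.bias π) (π := π)
    (by rw [← hB.gain_eq]; exact m.policyOp_gain π)
    (by rw [m.avg_r_eq_gain_add_bias π, hB.gain_eq])
    (fun s => by linarith [(abs_le.1 (hV s)).2]) s
  have hm := mul_nonneg hsp hT
  rw [abs_le]
  constructor <;> linarith

end Optimality

end FiniteMDP

/-! ### Combination of the bounds and choice of constants. -/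

theorem lemma5 {S A : Type*}
    [Fintype S] [Nonempty S] [MeasurableSpace S] [MeasurableSingletonClass S]
    [Fintype A] [Nonempty A] [MeasurableSpace A] [MeasurableSingletonClass A]
    (m : FiniteMDP S A) (γ : ℝ) (hγ : 1 / 2 ≤ γ) (hγ' : γ < 1)
    (V : S → ℝ) (π : Policy S A) (hπ : m.evalOp γ π V = m.bellmanOp γ V)
    (h : S → ℝ) (h_mod : m.ModifiedBellman m.optGain h) (h_unmod : m.UnmodifiedBellman m.optGain h)
    (πstar : Policy S A) (h_blackwell : m.IsBlackwellOptimal πstar)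
    (M : ℝ)
    (hM : M = min (spanSeminorm h)
      (spanSeminorm (m.bias πstar) + m.maxDropTime.toReal
        + spanSeminorm (m.bias πstar) * m.maxDropTime.toReal)) :
    m.dropTime π ≠ ⊤ ∧ m.maxDropTime ≠ ⊤ ∧
      ‖m.gain π - m.optGain‖ ≤
        ((m.dropTime π).toReal + 1) *
          ((1 - γ) * (4 + 7 * M) + 16 * ‖m.bellmanOp γ V - V‖) := by
  have hρ : ∀ s a, m.nextExp m.optGain s a ≤ m.optGain s := fun s a => (h_mod.1 s).2 ⟨a, rfl⟩
  refine ⟨FiniteMDP.dropTime_ne_top hρ π, FiniteMDP.maxDropTime_ne_top hρ, ?_⟩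
  have hγ0 : 0 < γ := by linarith
  have h1 : 0 < 1 - γ := by linarith
  set δ := ‖m.bellmanOp γ V - V‖ with hδ
  set T := (m.dropTime π).toReal with hT
  have hδ0 : 0 ≤ δ := norm_nonneg _
  have hT0 : 0 ≤ T := ENNReal.toReal_nonneg
  have hV : ∀ s, |m.bellmanOp γ V s - V s| ≤ δ := norm_le_pi_norm (m.bellmanOp γ V - V)
  have hsp := spanSeminorm_nonneg (m.bias πstar)
  have hD : 0 ≤ m.maxDropTime.toReal := ENNReal.toReal_nonneg
  have hM0 : 0 ≤ M := by
    rw [hM]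
    exact le_min (spanSeminorm_nonneg h) (by positivity)
  have hB : ∀ s, |V s - m.optGain s / (1 - γ)| ≤ M + δ / (1 - γ) := fun s => by
    rw [hM, ← min_add_add_right]
    exact le_min (FiniteMDP.abs_sub_optGain_le_of_bellman hγ0 hγ' h_mod h_unmod hV s)
      (FiniteMDP.abs_sub_optGain_le_of_blackwell hγ0 hγ' hρ h_blackwell hV s)
  have e1 : (1 - γ) * (δ / (1 - γ)) = δ := mul_div_cancel₀ _ h1.ne'
  have e2 : (1 - γ) * δ ≤ δ := mul_le_of_le_one_left hδ0 (by linarith)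
  have e3 : 0 ≤ (1 - γ) * M := mul_nonneg h1.le hM0
  -- With `B = M + δ / (1 - γ)`, the quantity `(1 - γ) (1 + 2 B + δ)` is at most `(1 - γ) (1 + 2 M)
  -- + 3 δ`; doubling it compensates for `γ ≥ 1/2`.
  set c := (1 - γ) * (2 + 4 * M) + 6 * δ with hc
  have hc0 : 0 ≤ c := by positivity
  have hbound : ∀ s, m.optGain s - m.gain π s ≤ c * T + (1 - γ) * (M + δ / (1 - γ)) + δ :=
    FiniteMDP.optGain_sub_gain_le hγ0 hγ' hρ hπ hB
      (fun s => by linarith [(abs_le.1 (hV s)).1]) hc0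
      (by linarith [mul_le_mul_of_nonneg_right hγ hc0])
  have hfin : c * T + (1 - γ) * (M + δ / (1 - γ)) + δ ≤
      (T + 1) * ((1 - γ) * (4 + 7 * M) + 16 * δ) := by
    have e4 : c ≤ (1 - γ) * (4 + 7 * M) + 16 * δ := by linarith
    have e5 := mul_le_mul_of_nonneg_right e4 hT0
    linarith
  refine (pi_norm_le_iff_of_nonneg (by positivity)).2 fun s => ?_
  rw [Pi.sub_apply, Real.norm_eq_abs, abs_sub_comm,
    abs_of_nonneg (sub_nonneg.2 (m.gain_le_optGain π s))]
  exact (hbound s).trans hfin
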